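/- A path in $\mathbb C$ is a continuous function $\gamma:[a,b]\to\mathbb C$ with $a<b$; its image is $\gamma^*=\gamma([a,b])$ and its endpoints are $\gamma^-=\gamma(a)$, $\gamma^+=\gamma(b)$. A subpath of $\gamma$ is its restriction to a non-degenerate closed subinterval of $[a,b]$, and the reverse of $\gamma$ is the path $t\mapsto\gamma(-t)$ on $[-b,-a]$. A path is admissible if it is rectifiable (has finite length) and has no constant subpaths. Let $X\subseteq\mathbb C$ be compact, let $\mathcal F$ be a collection of rectifiable paths in $X$, and let $f,g:X\to\mathbb C$ be continuous. Then $g$ is an $\mathcal F$-derivative of $f$ if $\int_\gamma g(z)\,dz=f(\gamma^+)-f(\gamma^-)$ for every $\gamma\in\mathcal F$, where the integral is the Riemann–Stieltjes integral of $g\circ\gamma$ with respect to $\gamma$. Theorem. Let $\Gamma:[a,b]\to\mathbb C$ be an admissible path, and let $\mathcal F$ be the collection of all subpaths of $\Gamma$ and all reverses of subpaths of $\Gamma$. (With $X=\Gamma^*$ and this $\mathcal F$, $\mathcal F$-derivatives are unique.) Let $D^\infty_{\mathcal F}(\Gamma^*)$ be the set of continuous functions $f:\Gamma^*\to\mathbb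 C$ that have $\mathcal F$-derivatives $f^{[k]}$ of all orders $k\ge 0$, where $f^{[0]}=f$ and $f^{[k+1]}$ is the $\mathcal F$-derivative of $f^{[k]}$. Let $(M_n)_{n=0}^\infty$ be a sequence of positive real numbers with $\sum_{n=1}^\infty M_n^{-1/n}=\infty$. Suppose that $f\in D^\infty_{\mathcal F}(\Gamma^*)$ and $z_0\in\Gamma^*$ satisfy $$\sup_{z\in\Gamma^*}|f^{[k]}(z)|\le M_k\quad\text{and}\quad f^{[k]}(z_0)=0\qquad\text{for all }k\ge 0.$$ Then $f(z)=0$ for all $z\in\Gamma^*$. -/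

import Mathlib

open Set Filter Topology

/-- A path in the complex plane: a continuous function `γ : [a, b] → ℂ` with `a < b`. It is stored
as a function on `ℝ` of which only the values on `[a, b]` are ever used. -/
structure PlanePath where
  a : ℝ
  b : ℝ
  lt : a < b
  toFun : ℝ → ℂ
  continuousOn : ContinuousOn toFun (Icc a b)

namespace PlanePath

instance : CoeFun PlanePath (fun _ => ℝ → ℂ) := ⟨PlanePath.toFun⟩

/-- The initial point `γ(a)`. -/
def initial (γ : PlanePath) : ℂ := γ γ.a

/-- The final point `γ(b)`. -/
def final (γ : PlanePath) : ℂ := γ γ.b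

/-- The image `γ* = γ([a, b])`. -/
def image (γ : PlanePath) : Set ℂ := γ.toFun '' Icc γ.a γ.b

/-- The length of a path: the supremum of the lengths of inscribed polygons. -/
noncomputable def length (γ : PlanePath) : ENNReal := eVariationOn γ.toFun (Icc γ.a γ.b)

/-- A path is rectifiable if its length is finite. -/
def IsRectifiable (γ : PlanePath) : Prop := γ.length < ⊤

/-- A path is constant if it takes only one value on its parameter interval. -/
def IsConstant (γ : PlanePath) : Prop := ∃ w : ℂ, ∀ t ∈ Icc γ.a γ.b, γ t = w

/-- The restriction of `γ` to a non-degenerate closed subinterval `[c, d]` of `[a, b]`. -/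
def restrict (γ : PlanePath) (c d : ℝ) (hac : γ.a ≤ c) (hcd : c < d) (hdb : d ≤ γ.b) :
    PlanePath where
  a := c
  b := d
  lt := hcd
  toFun := γ.toFun
  continuousOn := γ.continuousOn.mono (Icc_subset_Icc hac hdb)

/-- The reverse path `-γ : [-b, -a] → ℂ`, `(-γ)(t) = γ(-t)`. -/
def reverse (γ : PlanePath) : PlanePath where
  a := -γ.b
  b := -γ.a
  lt := neg_lt_neg γ.lt
  toFun := fun t => γ (-t)
  continuousOn := γ.continuousOn.comp continuous_neg.continuousOn
    (fun _ ht => ⟨le_neg_of_le_neg ht.2, neg_le_of_neg_le ht.1⟩)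

/-- The set of all subpaths of `γ`. -/
def subpaths (γ : PlanePath) : Set PlanePath :=
  {δ | ∃ (c d : ℝ) (hac : γ.a ≤ c) (hcd : c < d) (hdb : d ≤ γ.b), δ = γ.restrict c d hac hcd hdb}

/-- The collection of all subpaths of `γ` and of all reverses of subpaths of `γ`. -/
def subpathsAndReverses (γ : PlanePath) : Set PlanePath :=
  γ.subpaths ∪ reverse '' γ.subpaths

/-- A path is admissible if it is rectifiable and has no constant subpaths. -/
def IsAdmissible (γ : PlanePath) : Prop :=
  γ.IsRectifiable ∧ ∀ δ ∈ γ.subpaths, ¬ δ.IsConstant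

/-- `t 0 ≤ t 1 ≤ ⋯ ≤ t n` is a partition of `[a, b]` of mesh less than `δ`, with tags
`s i ∈ [t i, t (i + 1)]` for `i < n`. -/
structure IsTaggedPartition (a b δ : ℝ) (n : ℕ) (t s : ℕ → ℝ) : Prop where
  left : t 0 = a
  right : t n = b
  tag : ∀ i < n, s i ∈ Icc (t i) (t (i + 1))
  mesh : ∀ i < n, t (i + 1) - t i < δ

/-- The complex path integral `∫_γ g(z) dz` exists and equals `I`. It is the Riemann–Stieltjes
integral of `g ∘ γ` with respect to `γ`: the limit of the sums `∑ g(γ(sᵢ)) (γ(tᵢ₊₁) - γ(tᵢ))` over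
tagged partitions of the parameter interval, as the mesh tends to `0`. -/
def HasIntegral (γ : PlanePath) (g : ℂ → ℂ) (I : ℂ) : Prop :=
  ∀ ε : ℝ, 0 < ε → ∃ δ : ℝ, 0 < δ ∧ ∀ (n : ℕ) (t s : ℕ → ℝ),
    IsTaggedPartition γ.a γ.b δ n t s →
      ‖∑ i ∈ Finset.range n, g (γ (s i)) * (γ (t (i + 1)) - γ (t i)) - I‖ < ε

end PlanePath

/-- `g` is an `F`-derivative of `f` on `X`: both are continuous on `X` and
`∫_γ g(z) dz = f(γ⁺) - f(γ⁻)` for each path `γ ∈ F`. Only values on `X` matter if all paths of `F`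
lie in `X`. -/
def IsFDerivative (X : Set ℂ) (F : Set PlanePath) (f g : ℂ → ℂ) : Prop :=
  ContinuousOn f X ∧ ContinuousOn g X ∧ ∀ γ ∈ F, γ.HasIntegral g (f γ.final - f γ.initial)

open Classical in
/-- The `F`-derivative `f^[1]` of `f` on `X` (and `0` if there is none). For the paths considered
below its values on `X` do not depend on the choice, see `IsFDerivative.eqOn`. -/
noncomputable def fDeriv (X : Set ℂ) (F : Set PlanePath) (f : ℂ → ℂ) : ℂ → ℂ :=
  if h : ∃ g, IsFDerivative X F f g then h.choose else 0

/-- The `k`-th `F`-derivative `f^[k]`, with `f^[0] = f`. -/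
noncomputable def iterFDeriv (X : Set ℂ) (F : Set PlanePath) (k : ℕ) (f : ℂ → ℂ) : ℂ → ℂ :=
  (fDeriv X F)^[k] f

/-- The set `D^n_F(X)` of `n` times `F`-differentiable functions: `D^0_F(X) = C(X)`, and
`D^{n+1}_F(X)` is the set of all `F`-differentiable `f` with `f^[1] ∈ D^n_F(X)`. -/
noncomputable def fDiff (X : Set ℂ) (F : Set PlanePath) : ℕ → Set (ℂ → ℂ)
  | 0 => {f | ContinuousOn f X}
  | n + 1 => {f | (∃ g, IsFDerivative X F f g) ∧ fDeriv X F f ∈ fDiff X F n}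

/-- The set `D^∞_F(X)` of functions that have `F`-derivatives of all orders. -/
noncomputable def fDiffInfty (X : Set ℂ) (F : Set PlanePath) : Set (ℂ → ℂ) :=
  ⋂ n : ℕ, fDiff X F n

namespace PlanePath

/-- Tagged partitions of arbitrarily small mesh exist. -/
theorem exists_isTaggedPartition {a b δ : ℝ} (hab : a < b) (hδ : 0 < δ) :
    ∃ (n : ℕ) (t : ℕ → ℝ), Monotone t ∧ (∀ i ≤ n, t i ∈ Icc a b) ∧
      IsTaggedPartition a b δ n t t := by
  obtain ⟨n, hn⟩ := exists_nat_gt ((b - a) / δ)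
  have hn0 : (0 : ℝ) < n := lt_trans (div_pos (sub_pos.2 hab) hδ) hn
  have hq : 0 < (b - a) / n := div_pos (sub_pos.2 hab) hn0
  have hstep : (b - a) / n < δ := by
    rw [div_lt_iff₀ hδ] at hn
    rw [div_lt_iff₀ hn0]; linarith
  have hend : (n : ℝ) * ((b - a) / n) = b - a := by field_simp
  have hmono : Monotone (fun i : ℕ => a + i * ((b - a) / n)) := by
    intro i j hij
    have : (i : ℝ) ≤ j := by exact_mod_cast hij
    have := mul_le_mul_of_nonneg_right this hq.le
    simpa using this
  refine ⟨n, fun i => a + i * ((b - a) / n), hmono, ?_, ?_, ?_, ?_, ?_⟩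
  · intro i hi
    have h1 := hmono (Nat.zero_le i)
    have h2 := hmono hi
    simp only [Nat.cast_zero, zero_mul, add_zero, hend] at h1 h2
    exact ⟨h1, by linarith⟩
  · simp
  · simp only [hend]; ring
  · intro i _
    exact ⟨le_rfl, hmono (Nat.le_succ i)⟩
  · intro i _
    push_cast
    linarith

/-- The value of a path integral is unique. -/
theorem HasIntegral.unique {γ : PlanePath} {g : ℂ → ℂ} {I J : ℂ}
    (hI : γ.HasIntegral g I) (hJ : γ.HasIntegral g J) : I = J := by
  by_contra hne
  have hpos : 0 < ‖I - J‖ := norm_pos_iff.2 (sub_ne_zero.2 hne)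
  obtain ⟨δ₁, h₁, H₁⟩ := hI (‖I - J‖ / 2) (half_pos hpos)
  obtain ⟨δ₂, h₂, H₂⟩ := hJ (‖I - J‖ / 2) (half_pos hpos)
  obtain ⟨n, t, -, -, ht⟩ := exists_isTaggedPartition γ.lt (lt_min h₁ h₂)
  have A := H₁ n t t ⟨ht.left, ht.right, ht.tag, fun i hi => (ht.mesh i hi).trans_le (min_le_left _ _)⟩
  have B := H₂ n t t ⟨ht.left, ht.right, ht.tag, fun i hi => (ht.mesh i hi).trans_le (min_le_right _ _)⟩
  rw [norm_sub_rev] at A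
  have := norm_sub_le_norm_sub_add_norm_sub I
    (∑ i ∈ Finset.range n, g (γ (t i)) * (γ (t (i + 1)) - γ (t i))) J
  linarith

/-- If `∫_γ g₁ dz = ∫_γ g₂ dz` and `g₁ - g₂` stays within `η` of `w` along `γ`, then
`|w| |γ⁺ - γ⁻| ≤ η · length(γ)`. -/
theorem norm_mul_norm_le {γ : PlanePath} (hγ : γ.IsRectifiable) {g₁ g₂ : ℂ → ℂ} {I w : ℂ} {η : ℝ}
    (hη : 0 ≤ η) (h₁ : γ.HasIntegral g₁ I) (h₂ : γ.HasIntegral g₂ I)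
    (h : ∀ t ∈ Icc γ.a γ.b, ‖g₁ (γ t) - g₂ (γ t) - w‖ ≤ η) :
    ‖w‖ * ‖γ.final - γ.initial‖ ≤ η * γ.length.toReal := by
  refine le_of_forall_pos_le_add fun ε hε => ?_
  obtain ⟨δ₁, hδ₁, H₁⟩ := h₁ (ε / 2) (half_pos hε)
  obtain ⟨δ₂, hδ₂, H₂⟩ := h₂ (ε / 2) (half_pos hε)
  obtain ⟨n, t, hm, hmem, ht⟩ := exists_isTaggedPartition γ.lt (lt_min hδ₁ hδ₂)
  have A := H₁ n t t ⟨ht.left, ht.right, ht.tag, fun i hi => (ht.mesh i hi).trans_le (min_le_left _ _)⟩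
  have B := H₂ n t t ⟨ht.left, ht.right, ht.tag, fun i hi => (ht.mesh i hi).trans_le (min_le_right _ _)⟩
  set S₁ := ∑ i ∈ Finset.range n, g₁ (γ (t i)) * (γ (t (i + 1)) - γ (t i)) with hS₁
  set S₂ := ∑ i ∈ Finset.range n, g₂ (γ (t i)) * (γ (t (i + 1)) - γ (t i)) with hS₂
  have htel : ∑ i ∈ Finset.range n, (γ (t (i + 1)) - γ (t i)) = γ.final - γ.initial := by
    rw [Finset.sum_range_sub (fun i => γ (t i)), ht.left, ht.right]; rfl
  have hvar : ∑ i ∈ Finset.range n, ‖γ (t (i + 1)) - γ (t i)‖ ≤ γ.length.toReal := by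
    have key : ∑ i ∈ Finset.range n, edist (γ (t (i + 1))) (γ (t i)) ≤ γ.length :=
      eVariationOn.sum_le_of_monotoneOn_Iic (f := γ.toFun) (s := Icc γ.a γ.b)
        (hm.monotoneOn _) (fun i hi => hmem i hi)
    have := ENNReal.toReal_mono hγ.ne key
    rw [ENNReal.toReal_sum (fun i _ => edist_ne_top _ _)] at this
    simpa [edist_dist, dist_eq_norm, ENNReal.toReal_ofReal] using this
  have hdiff : w * (γ.final - γ.initial) = (S₁ - S₂)
      - ∑ i ∈ Finset.range n, (g₁ (γ (t i)) - g₂ (γ (t i)) - w) * (γ (t (i + 1)) - γ (t i)) := by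
    rw [← htel, hS₁, hS₂, Finset.mul_sum, ← Finset.sum_sub_distrib, ← Finset.sum_sub_distrib]
    exact Finset.sum_congr rfl fun i _ => by ring
  have hS : ‖S₁ - S₂‖ ≤ ε := by
    have := norm_sub_le_norm_sub_add_norm_sub S₁ I S₂
    rw [norm_sub_rev I S₂] at this
    linarith
  have hE : ‖∑ i ∈ Finset.range n, (g₁ (γ (t i)) - g₂ (γ (t i)) - w) * (γ (t (i + 1)) - γ (t i))‖
      ≤ η * γ.length.toReal := by
    refine (norm_sum_le _ _).trans (le_trans ?_ (mul_le_mul_of_nonneg_left hvar hη))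
    rw [Finset.mul_sum]
    refine Finset.sum_le_sum fun i hi => ?_
    rw [norm_mul]
    exact mul_le_mul_of_nonneg_right (h _ (hmem i (Finset.mem_range.1 hi).le)) (norm_nonneg _)
  rw [← norm_mul, hdiff]
  have := norm_sub_le (S₁ - S₂) (∑ i ∈ Finset.range n,
    (g₁ (γ (t i)) - g₂ (γ (t i)) - w) * (γ (t (i + 1)) - γ (t i)))
  linarith

end PlanePath

/-- Along an admissible path `Γ`, two `F`-derivatives of the same function agree on `Γ*`; so
`f^[k]` is well defined there. -/
theorem IsFDerivative.eqOn {Γ : PlanePath} (hΓ : Γ.IsAdmissible) {f g₁ g₂ : ℂ → ℂ}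
    (h₁ : IsFDerivative Γ.image Γ.subpathsAndReverses f g₁)
    (h₂ : IsFDerivative Γ.image Γ.subpathsAndReverses f g₂) : EqOn g₁ g₂ Γ.image := by
  rintro _ ⟨t₀, ht₀, rfl⟩
  by_contra hne
  set w : ℂ := g₁ (Γ t₀) - g₂ (Γ t₀) with hw
  have hw0 : 0 < ‖w‖ := norm_pos_iff.2 (sub_ne_zero.2 hne)
  have hmaps : MapsTo Γ.toFun (Icc Γ.a Γ.b) Γ.image := mapsTo_image _ _
  have hcont : ContinuousOn (fun t => g₁ (Γ t) - g₂ (Γ t)) (Icc Γ.a Γ.b) :=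
    (h₁.2.1.comp Γ.continuousOn hmaps).sub (h₂.2.1.comp Γ.continuousOn hmaps)
  obtain ⟨δ, hδ, H⟩ := Metric.continuousOn_iff.1 hcont t₀ ht₀ (‖w‖ / 2) (half_pos hw0)
  have hab := Γ.lt
  obtain ⟨c, d, hac, hcd, hdb, hc, hd⟩ : ∃ c d : ℝ, Γ.a ≤ c ∧ c < d ∧ d ≤ Γ.b ∧
      t₀ - δ < c ∧ d < t₀ + δ := by
    refine ⟨max Γ.a (t₀ - δ / 2), min Γ.b (t₀ + δ / 2), le_max_left _ _, ?_, min_le_left _ _,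
      lt_max_of_lt_right (by linarith), min_lt_of_right_lt (by linarith)⟩
    refine max_lt (lt_min hab ?_) (lt_min ?_ ?_) <;> linarith [ht₀.1, ht₀.2]
  have hfin : ∀ u v : ℝ, Γ.a ≤ u → v ≤ Γ.b → eVariationOn Γ.toFun (Icc u v) ≠ ⊤ := fun u v hu hv =>
    ((eVariationOn.mono _ (Icc_subset_Icc hu hv)).trans_lt hΓ.1).ne
  have hstep : ∀ u v : ℝ, c ≤ u → u ≤ v → v ≤ d →
      edist (Γ v) (Γ u) ≤ 2⁻¹ * eVariationOn Γ.toFun (Icc u v) := by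
    intro u v hcu huv hvd
    rcases huv.eq_or_lt with rfl | huv
    · simp
    have hau := hac.trans hcu
    have hvb := hvd.trans hdb
    have hmem : Γ.restrict u v hau huv hvb ∈ Γ.subpathsAndReverses :=
      Or.inl ⟨u, v, hau, huv, hvb, rfl⟩
    have key := PlanePath.norm_mul_norm_le (γ := Γ.restrict u v hau huv hvb) (w := w)
      (η := ‖w‖ / 2) (lt_top_iff_ne_top.2 (hfin u v hau hvb)) (half_pos hw0).le
      (h₁.2.2 _ hmem) (h₂.2.2 _ hmem) (fun t ht => by
        have ht' : u ≤ t ∧ t ≤ v := ht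
        have := H t ⟨hau.trans ht'.1, ht'.2.trans hvb⟩
          (by rw [Real.dist_eq, abs_lt]; constructor <;> linarith)
        rw [dist_eq_norm] at this
        exact this.le)
    have key' : ‖Γ v - Γ u‖ ≤ 2⁻¹ * (eVariationOn Γ.toFun (Icc u v)).toReal := by
      have : ‖w‖ * ‖Γ v - Γ u‖ ≤ ‖w‖ * (2⁻¹ * (eVariationOn Γ.toFun (Icc u v)).toReal) := by
        refine le_trans key (le_of_eq ?_)
        show ‖w‖ / 2 * (eVariationOn Γ.toFun (Icc u v)).toReal = _
        ring
      exact le_of_mul_le_mul_left this hw0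
    rw [edist_dist, dist_eq_norm]
    refine (ENNReal.ofReal_le_ofReal key').trans ?_
    rw [ENNReal.ofReal_mul (by norm_num), ENNReal.ofReal_toReal (hfin u v hau hvb),
      ENNReal.ofReal_inv_of_pos (by norm_num)]
    simp
  have hadd : ∀ (t : ℕ → ℝ), Monotone t → (∀ i, t i ∈ Icc c d) → ∀ n : ℕ,
      ∑ i ∈ Finset.range n, eVariationOn Γ.toFun (Icc (t i) (t (i + 1)))
        ≤ eVariationOn Γ.toFun (Icc (t 0) (t n)) := by
    intro t hm hmem n
    induction n with
    | zero => simp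
    | succ n ih =>
      rw [Finset.sum_range_succ]
      refine (add_le_add_left ih _).trans (le_of_eq ?_)
      have := eVariationOn.Icc_add_Icc Γ.toFun (s := univ) (hm (Nat.zero_le n))
        (hm (Nat.le_succ n)) (mem_univ _)
      simpa using this
  have hhalf : eVariationOn Γ.toFun (Icc c d) ≤ 2⁻¹ * eVariationOn Γ.toFun (Icc c d) := by
    refine iSup_le fun p => ?_
    obtain ⟨n, t, hm, hmem⟩ := p
    calc ∑ i ∈ Finset.range n, edist (Γ (t (i + 1))) (Γ (t i))
        ≤ ∑ i ∈ Finset.range n, 2⁻¹ * eVariationOn Γ.toFun (Icc (t i) (t (i + 1))) :=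
          Finset.sum_le_sum fun i _ => hstep _ _ (hmem i).1 (hm (Nat.le_succ i)) (hmem _).2
      _ = 2⁻¹ * ∑ i ∈ Finset.range n, eVariationOn Γ.toFun (Icc (t i) (t (i + 1))) :=
          (Finset.mul_sum _ _ _).symm
      _ ≤ 2⁻¹ * eVariationOn Γ.toFun (Icc c d) := by
          gcongr
          exact (hadd t hm hmem n).trans
            (eVariationOn.mono _ (Icc_subset_Icc (hmem 0).1 (hmem n).2))
  have hzero : eVariationOn Γ.toFun (Icc c d) = 0 := by
    by_contra h0
    have hlt := ENNReal.half_lt_self h0 (hfin c d hac hdb)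
    rw [ENNReal.div_eq_inv_mul] at hlt
    exact absurd hhalf (not_le.2 hlt)
  refine hΓ.2 (Γ.restrict c d hac hcd hdb) ⟨c, d, hac, hcd, hdb, rfl⟩ ⟨Γ c, fun t ht => ?_⟩
  have := eVariationOn.edist_le Γ.toFun (s := Icc c d) ht (left_mem_Icc.2 hcd.le)
  rw [hzero] at this
  exact edist_le_zero.1 this

/-! The proof is Bang's real-variable argument, run in arc length along `Γ`. Write u_j for the
modulus of f^[j] along the path. Integrating over subpaths makes u_j grow at most by the integral of
u_{j+1} in arc length (`IsRectifiable.isExpControlled`), and nothing else about the path is needed.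
Replace log M_n by its largest convex minorant A, with increasing slopes l. Where the slope jumps, A
equals log M_n, so the a priori bound is available exactly there. If u_j ≤ exp(A_j + j - (k+1)) at a
point for all j with l_j ≤ l_k, then moving by exp(-l_k - 1) loses only a factor e
(`IsExpControlled.le_exp_of_abs_sub_le`). At the flat point these bounds hold for every k. Chaining
moves at levels K, K+1, ... covers any distance once ∑ exp(-l_k) diverges, and leaves |f| ≤ exp(A_0
- K) with K arbitrary. That divergence follows from the hypothesis by Carleman's inequality
(`sum_exp_neg_average_le`), as the averages of l are essentially A_n / n ≤ log M_n / n. If log M_n /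
n does not tend to infinity, a direct estimate suffices. -/

/-! ### Carleman's inequality -/

section CarlemanInequality

/-- `n log n - n ≤ log n!`, the factorial being written as a product over `k + 1` for `k < n`. -/
theorem mul_log_sub_le_sum_log (n : ℕ) :
    n * Real.log n - n ≤ ∑ k ∈ Finset.range n, Real.log (k + 1) := by
  rcases n.eq_zero_or_pos with rfl | hn
  · simp
  have hn' : (0 : ℝ) < n := by exact_mod_cast hn
  -- n^n / n! is one term of the series of e^n.
  have h := Real.pow_div_factorial_le_exp _ hn'.le n
  have hf : (0 : ℝ) < n.factorial := by exact_mod_cast n.factorial_pos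
  have h2 := Real.log_le_log (by positivity) h
  rw [Real.log_exp, Real.log_div (by positivity) hf.ne', Real.log_pow,
    ← Finset.prod_range_add_one_eq_factorial, Nat.cast_prod, Real.log_prod] at h2
  · push_cast at h2
    linarith
  · intro i _
    positivity

/-- The geometric mean of `exp (-l 0), …, exp (-l n)` is at most a weighted arithmetic mean. -/
theorem exp_neg_average_le (l : ℕ → ℝ) (n : ℕ) :
    Real.exp (-(∑ k ∈ Finset.range (n + 1), l k) / (n + 1)) ≤
      2 * Real.exp 1 * ((∑ k ∈ Finset.range (n + 1), (k + 1) * Real.exp (-l k)) /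
        ((n + 1) * (n + 2))) := by
  have hn : (0 : ℝ) < n + 1 := by positivity
  have hlog : (n + 1) * Real.log (n + 1) - (n + 1) ≤
      ∑ k ∈ Finset.range (n + 1), Real.log (k + 1) := by
    simpa using mul_log_sub_le_sum_log (n + 1)
  -- Jensen after inserting the weights k + 1, whose geometric mean is at least (n + 1) / e.
  have hJ : Real.exp (∑ k ∈ Finset.range (n + 1), (1 / (n + 1 : ℝ)) • (Real.log (k + 1) - l k)) ≤
      ∑ k ∈ Finset.range (n + 1), (1 / (n + 1 : ℝ)) • Real.exp (Real.log (k + 1) - l k) :=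
    convexOn_exp.map_sum_le (fun _ _ => by positivity) (by simp; field_simp)
      (fun _ _ => mem_univ _)
  simp only [smul_eq_mul] at hJ
  rw [← Finset.mul_sum, ← Finset.mul_sum, Finset.sum_sub_distrib] at hJ
  have hterm : ∀ k : ℕ, Real.exp (Real.log (k + 1) - l k) = (k + 1) * Real.exp (-l k) := by
    intro k
    rw [sub_eq_add_neg, Real.exp_add, Real.exp_log (by positivity)]
  simp only [hterm] at hJ
  set S := ∑ k ∈ Finset.range (n + 1), (k + 1) * Real.exp (-l k) with hS
  have hS0 : 0 ≤ S := Finset.sum_nonneg fun k _ => by positivity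
  have hexp : -(∑ k ∈ Finset.range (n + 1), l k) / (n + 1) ≤
      1 / (n + 1) * (∑ k ∈ Finset.range (n + 1), Real.log (k + 1) -
        ∑ k ∈ Finset.range (n + 1), l k) + (1 - Real.log (n + 1)) := by
    rw [← sub_nonneg]
    have : 1 / (n + 1) * (∑ k ∈ Finset.range (n + 1), Real.log (k + 1) -
        ∑ k ∈ Finset.range (n + 1), l k) + (1 - Real.log (n + 1)) -
        -(∑ k ∈ Finset.range (n + 1), l k) / (n + 1) =
        (∑ k ∈ Finset.range (n + 1), Real.log (k + 1) -
          ((n + 1) * Real.log (n + 1) - (n + 1))) / (n + 1) := by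
      field_simp
      ring
    rw [this]
    exact div_nonneg (by linarith) hn.le
  calc Real.exp (-(∑ k ∈ Finset.range (n + 1), l k) / (n + 1))
      ≤ _ := Real.exp_le_exp.2 hexp
    _ ≤ 1 / (n + 1) * S * (Real.exp 1 / (n + 1)) := by
        rw [Real.exp_add, Real.exp_sub, Real.exp_log hn]
        gcongr
    -- The factor 2 pays for replacing (n + 1)^2 by (n + 1)(n + 2), which telescopes on summation.
    _ ≤ 2 * Real.exp 1 * (S / ((n + 1) * (n + 2))) := by
        have h1 : 2 * Real.exp 1 * (S / ((n + 1) * (n + 2))) -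
            1 / (n + 1) * S * (Real.exp 1 / (n + 1)) =
            Real.exp 1 * S * n / ((n + 1) ^ 2 * (n + 2)) := by
          field_simp
          ring
        rw [← sub_nonneg, h1]
        positivity

/-- **Carleman's inequality** for finite sums, with the constant `2e`. -/
theorem sum_exp_neg_average_le (l : ℕ → ℝ) (N : ℕ) :
    ∑ n ∈ Finset.range N, Real.exp (-(∑ k ∈ Finset.range (n + 1), l k) / (n + 1)) ≤
      2 * Real.exp 1 * ∑ k ∈ Finset.range N, Real.exp (-l k) := by
  -- Interchanging the sums, the k-th term gets the coefficient (k + 1)(1 / (k + 1) - 1 / (N + 1)).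
  have hsum : ∀ N : ℕ, ∑ n ∈ Finset.range N,
      (∑ k ∈ Finset.range (n + 1), (k + 1) * Real.exp (-l k)) / (((n : ℝ) + 1) * (n + 2)) =
      ∑ k ∈ Finset.range N, Real.exp (-l k) -
        (∑ k ∈ Finset.range N, (k + 1) * Real.exp (-l k)) / (N + 1) := by
    intro N
    induction N with
    | zero => simp
    | succ N ih =>
      rw [Finset.sum_range_succ, ih, Finset.sum_range_succ _ N, Finset.sum_range_succ _ N]
      push_cast
      field_simp
      ring
  calc _ ≤ _ := Finset.sum_le_sum fun n _ => exp_neg_average_le l n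
    _ = 2 * Real.exp 1 * (∑ k ∈ Finset.range N, Real.exp (-l k) -
        (∑ k ∈ Finset.range N, (k + 1) * Real.exp (-l k)) / (N + 1)) := by
      rw [← Finset.mul_sum, hsum]
    _ ≤ _ := by
      gcongr
      exact sub_le_self _ (div_nonneg (Finset.sum_nonneg fun k _ => by positivity) (by positivity))

end CarlemanInequality

/-! ### Convex regularization of the sequence of logarithms -/

section ConvexMinorant

/-- The largest convex minorant of a sequence `L`, as the supremum of its affine minorants. -/
noncomputable def convexMinorant (L : ℕ → ℝ) (n : ℕ) : ℝ :=
  sSup {x | ∃ α β : ℝ, (∀ k : ℕ, α * k + β ≤ L k) ∧ x = α * n + β}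

variable {L : ℕ → ℝ}

theorem affine_le_convexMinorant {α β : ℝ} (h : ∀ k : ℕ, α * k + β ≤ L k) (n : ℕ) :
    α * n + β ≤ convexMinorant L n :=
  le_csSup ⟨L n, by rintro _ ⟨α, β, h, rfl⟩; exact h n⟩ ⟨α, β, h, rfl⟩

theorem exists_affine_le (hL : Tendsto (fun n : ℕ => L n / n) atTop atTop) (α : ℝ) :
    ∃ β : ℝ, ∀ k : ℕ, α * k + β ≤ L k := by
  obtain ⟨N, hN⟩ := eventually_atTop.1 ((tendsto_atTop.1 hL α).and (eventually_gt_atTop 0))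
  obtain ⟨B, hB⟩ := ((Finset.range N).image fun k : ℕ => L k - α * k).bddBelow
  refine ⟨min B 0, fun k => ?_⟩
  rcases lt_or_ge k N with hk | hk
  · have := hB (Finset.mem_coe.2 (Finset.mem_image_of_mem _ (Finset.mem_range.2 hk)))
    linarith [min_le_left B 0]
  · obtain ⟨h1, h2⟩ := hN k hk
    rw [le_div_iff₀ (by exact_mod_cast h2)] at h1
    linarith [min_le_right B 0]

variable (hL : Tendsto (fun n : ℕ => L n / n) atTop atTop)
include hL

theorem convexMinorant_le_of_forall {n : ℕ} {c : ℝ}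
    (h : ∀ α β : ℝ, (∀ k : ℕ, α * k + β ≤ L k) → α * n + β ≤ c) : convexMinorant L n ≤ c := by
  obtain ⟨β, hβ⟩ := exists_affine_le hL 0
  refine csSup_le ⟨_, 0, β, hβ, rfl⟩ ?_
  rintro _ ⟨α, β, h', rfl⟩
  exact h α β h'

theorem convexMinorant_le (n : ℕ) : convexMinorant L n ≤ L n :=
  convexMinorant_le_of_forall hL fun _ _ h => h n

/-- Convexity passes to suprema: each affine minorant takes at n + 1 the mean of its values at n and
n + 2. -/
theorem monotone_convexMinorant_succ_sub :
    Monotone fun n => convexMinorant L (n + 1) - convexMinorant L n := by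
  refine monotone_nat_of_le_succ fun n => ?_
  have : convexMinorant L (n + 1) ≤ (convexMinorant L n + convexMinorant L (n + 1 + 1)) / 2 := by
    refine convexMinorant_le_of_forall hL fun α β h => ?_
    have h1 := affine_le_convexMinorant h n
    have h2 := affine_le_convexMinorant h (n + 1 + 1)
    push_cast at h2 ⊢
    linarith
  linarith

/-- A sequence with monotone increments lies above its tangent lines. -/
theorem tangent_le_convexMinorant (n k : ℕ) {α : ℝ}
    (h₁ : convexMinorant L (n + 1) - convexMinorant L n ≤ α)
    (h₂ : α ≤ convexMinorant L (n + 2) - convexMinorant L (n + 1)) :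
    convexMinorant L (n + 1) + α * ((k : ℝ) - (n + 1)) ≤ convexMinorant L k := by
  have hm := monotone_convexMinorant_succ_sub hL
  rcases le_total (n + 1) k with hk | hk
  · induction k, hk using Nat.le_induction with
    | base => simp
    | succ k hk ih =>
      have := hm hk
      simp only at this
      push_cast
      linarith
  · induction hk using Nat.decreasingInduction with
    | self => simp
    | of_succ k hk ih =>
      have := hm (Nat.lt_succ_iff.1 hk)
      simp only at this
      push_cast at ih
      linarith

/-- At a strict corner lying below `L` the minorant could be raised, against maximality: a line
through a slightly higher point, with slope midway between the two one-sided slopes, still stays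
below `L`. -/
theorem convexMinorant_eq_of_lt {n : ℕ}
    (h : convexMinorant L (n + 1) - convexMinorant L n <
      convexMinorant L (n + 2) - convexMinorant L (n + 1)) :
    convexMinorant L (n + 1) = L (n + 1) := by
  by_contra hne
  have hlt := lt_of_le_of_ne (convexMinorant_le hL (n + 1)) hne
  set p := convexMinorant L (n + 1) - convexMinorant L n with hp
  set q := convexMinorant L (n + 2) - convexMinorant L (n + 1) with hq
  set A := convexMinorant L (n + 1) with hA
  -- At integer distance at least 1 from the corner, the mean slope leaves room (q - p) / 2 below
  -- the tangents.
  set ε := min ((q - p) / 2) (L (n + 1) - A) with hε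
  have hε0 : 0 < ε := lt_min (by linarith) (by linarith)
  have hε1 : ε ≤ (q - p) / 2 := min_le_left _ _
  have hε2 : ε ≤ L (n + 1) - A := min_le_right _ _
  have key : ∀ k : ℕ, (p + q) / 2 * k + (A + ε - (p + q) / 2 * (n + 1)) ≤ L k := by
    intro k
    rcases lt_trichotomy k (n + 1) with hk | rfl | hk
    · have h1 := (tangent_le_convexMinorant hL n k le_rfl h.le).trans (convexMinorant_le hL k)
      have h2 : (k : ℝ) + 1 ≤ n + 1 := by exact_mod_cast hk
      nlinarith
    · push_cast
      linarith
    · have h1 := (tangent_le_convexMinorant hL n k h.le le_rfl).trans (convexMinorant_le hL k)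
      have h2 : (n : ℝ) + 1 + 1 ≤ k := by exact_mod_cast hk
      nlinarith
  have := affine_le_convexMinorant key (n + 1)
  push_cast at this
  linarith

/-- Superlinear growth of `L` admits affine minorants of slope c + 1, which slopes bounded by c
cannot follow. -/
theorem exists_lt_convexMinorant_succ_sub (c : ℝ) :
    ∃ n, c < convexMinorant L (n + 1) - convexMinorant L n := by
  by_contra! h
  obtain ⟨β, hβ⟩ := exists_affine_le hL (c + 1)
  have hb : ∀ n : ℕ, convexMinorant L n ≤ convexMinorant L 0 + c * n := by
    intro n
    induction n with
    | zero => simp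
    | succ n ih =>
      push_cast
      linarith [h n]
  obtain ⟨n, hn⟩ := exists_nat_gt (convexMinorant L 0 - β)
  linarith [hb n, affine_le_convexMinorant hβ n]

end ConvexMinorant

/-! ### Propagation of bounds from a point -/

/-- The sequence of functions `u` obeys an integral inequality `u j ≤ u j x + ∫ u (j + 1) dv` on
`s`, in the form in which it is applied: to exponential bounds. -/
def IsExpControlled (u : ℕ → ℝ → ℝ) (v : ℝ → ℝ) (s : Set ℝ) : Prop :=
  ∀ (j : ℕ), ∀ x ∈ s, ∀ y ∈ s, ∀ C r : ℝ, 0 ≤ C → 0 < r →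
    (∀ τ ∈ s, u (j + 1) τ ≤ C * Real.exp (r * |v τ - v x|)) →
    u j y ≤ u j x + C * ((Real.exp (r * |v y - v x|) - 1) / r)

section ExpControlled

variable {u : ℕ → ℝ → ℝ} {v : ℝ → ℝ} {s : Set ℝ} (hu : IsExpControlled u v s)
include hu

/-- Bounds of `u P` everywhere and of all `u j` with `j < P` at one point spread, with exponential
growth, to all points. -/
theorem IsExpControlled.le_mul_exp {w : ℕ → ℝ} {r : ℝ} {P : ℕ} {x : ℝ} (hx : x ∈ s)
    (hw : ∀ j, 0 ≤ w j) (hr : 0 < r) (hwr : ∀ j < P, w (j + 1) ≤ r * w j)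
    (hP : ∀ t ∈ s, u P t ≤ w P) (hxw : ∀ j < P, u j x ≤ w j) {j : ℕ} (hj : j ≤ P) :
    ∀ t ∈ s, u j t ≤ w j * Real.exp (r * |v t - v x|) := by
  induction hj using Nat.decreasingInduction with
  | self =>
    intro t ht
    refine (hP t ht).trans (le_mul_of_one_le_right (hw P) (Real.one_le_exp ?_))
    positivity
  | of_succ k hk ih =>
    intro t ht
    -- Integrating the exponential divides by r, which `hwr` compensates; the -1 from the lower
    -- limit cancels the bound w k at x.
    have h := hu k x hx t ht (w (k + 1)) r (hw _) hr ih
    have h1 : 0 ≤ (Real.exp (r * |v t - v x|) - 1) / r :=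
      div_nonneg (sub_nonneg.2 (Real.one_le_exp (by positivity))) hr.le
    have h2 := mul_le_mul_of_nonneg_right (hwr k hk) h1
    have h3 : r * w k * ((Real.exp (r * |v t - v x|) - 1) / r) =
        w k * (Real.exp (r * |v t - v x|) - 1) := by
      field_simp
    linarith [hxw k hk]

/-- A flat function whose derivatives satisfy `u n ≤ exp (c n)` for infinitely many `n` vanishes. -/
theorem IsExpControlled.le_zero_of_frequently {L : ℕ → ℝ} {c : ℝ} {x : ℝ} (hx : x ∈ s)
    (hL : ∀ j, ∀ t ∈ s, u j t ≤ Real.exp (L j)) (hc : ∃ᶠ n : ℕ in atTop, L n ≤ c * n)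
    (h0 : ∀ j, u j x ≤ 0) : ∀ t ∈ s, u 0 t ≤ 0 := by
  intro t ht
  have hlim : Tendsto (fun n : ℕ => Real.exp (-(n : ℝ)) *
      Real.exp (Real.exp (c + 1) * |v t - v x|)) atTop (𝓝 0) := by
    simpa using (Real.tendsto_exp_neg_atTop_nhds_zero.comp tendsto_natCast_atTop_atTop).mul_const
      (Real.exp (Real.exp (c + 1) * |v t - v x|))
  refine ge_of_tendsto_of_frequently hlim (hc.mono fun n hn => ?_)
  -- Geometric weights with value exp(c n) at j = n; the ratio exp(c + 1) makes the weight at 0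
  -- equal to exp(-n).
  have h := hu.le_mul_exp (w := fun j => Real.exp (c * n + (c + 1) * (j - n))) (P := n) hx
    (fun j => (Real.exp_pos _).le) (Real.exp_pos (c + 1)) (fun j _ => ?_) (fun t ht => ?_)
    (fun j _ => (h0 j).trans (Real.exp_pos _).le) n.zero_le t ht
  · refine h.trans (le_of_eq ?_)
    congr 2
    push_cast
    ring
  · rw [← Real.exp_add]
    refine Real.exp_le_exp.2 (le_of_eq ?_)
    push_cast
    ring
  · refine (hL n t ht).trans (Real.exp_le_exp.2 ?_)
    simpa using hn

/-! ### Bang's chaining argument -/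

variable {L A l : ℕ → ℝ} (hA : ∀ n, A (n + 1) = A n + l n) (hl : Monotone l)
  (hl' : ∀ c, ∃ n, c < l n) (hAL : ∀ n, l n < l (n + 1) → A (n + 1) = L (n + 1))
  (hL : ∀ j, ∀ t ∈ s, u j t ≤ Real.exp (L j))
include hA hl hl' hAL hL

/-- Moving by arc length at most `exp (-l k) / e` costs at most a factor `e`. -/
theorem IsExpControlled.le_exp_of_abs_sub_le {k : ℕ} {x y : ℝ} (hx : x ∈ s) (hy : y ∈ s)
    (hxy : |v y - v x| ≤ Real.exp (-l k - 1))
    (h : ∀ j, l j ≤ l k → u j x ≤ Real.exp (A j + j - (k + 1))) {j : ℕ} (hj : l j ≤ l k) :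
    u j y ≤ Real.exp (A j + j - k) := by
  classical
  -- P is the first index whose slope exceeds l k. The slope jumps there, so `A` and `L` agree at P.
  have hP := Nat.find_spec (hl' (l k))
  have hmin := fun m => Nat.find_min (m := m) (hl' (l k))
  set P := Nat.find (hl' (l k)) with hPdef
  have hlt : ∀ {i}, l i ≤ l k → i < P := fun hi => hl.reflect_lt (hi.trans_lt hP)
  obtain ⟨p, hp⟩ : ∃ p, P = p + 1 := Nat.exists_eq_succ_of_ne_zero (hlt hj).ne_bot
  have hAP : A P = L P := by
    rw [hp] at hP ⊢
    exact hAL p ((not_lt.1 (hmin p (by omega))).trans_lt hP)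
  -- Hence the a priori bound exp(A P) already lies below the weight exp(A P + P - (k + 1)).
  have hkP : (k : ℝ) + 1 ≤ P := by exact_mod_cast hlt le_rfl
  -- Consecutive weights have ratio exp(l j + 1) ≤ r = exp(l k + 1) below P, and r times the
  -- distance moved is at most 1.
  have key := hu.le_mul_exp (w := fun j => Real.exp (A j + j - (k + 1))) (P := P) hx
    (fun j => (Real.exp_pos _).le) (Real.exp_pos (l k + 1)) (fun i hi => ?_) (fun t ht => ?_)
    (fun i hi => h i (not_lt.1 (hmin i hi))) (hlt hj).le y hy
  · refine key.trans ?_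
    rw [← Real.exp_add]
    refine Real.exp_le_exp.2 ?_
    have := mul_le_mul_of_nonneg_left hxy (Real.exp_pos (l k + 1)).le
    rw [← Real.exp_add, show l k + 1 + (-l k - 1) = 0 by ring, Real.exp_zero] at this
    linarith
  · rw [← Real.exp_add]
    refine Real.exp_le_exp.2 ?_
    rw [hA]
    push_cast
    linarith [not_lt.1 (hmin i hi)]
  · refine (hL P t ht).trans (Real.exp_le_exp.2 ?_)
    linarith

/-- Flatness gives the bound at x at every level; each move towards y lowers the level by one, until
K is reached. -/
theorem IsExpControlled.le_exp_of_abs_sub_le_sum (hv : ContinuousOn v s) (hs : IsPreconnected s)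
    {x : ℝ} (hx : x ∈ s) (h0 : ∀ j, u j x ≤ 0) (n : ℕ) :
    ∀ (K : ℕ), ∀ y ∈ s, |v y - v x| ≤ ∑ k ∈ Finset.range n, Real.exp (-l (K + k) - 1) →
      ∀ j, l j ≤ l K → u j y ≤ Real.exp (A j + j - K) := by
  induction n with
  | zero =>
    intro K y hy hxy j hj
    rw [Finset.sum_range_zero] at hxy
    -- Equal values of v do not force y = x, so a move of length zero is made.
    exact hu.le_exp_of_abs_sub_le hA hl hl' hAL hL hx hy (hxy.trans (Real.exp_pos _).le)
      (fun i _ => (h0 i).trans (Real.exp_pos _).le) hj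
  | succ n ih =>
    intro K y hy hxy j hj
    -- The term of level K is the last move, from z to y; the rest of the chain reaches z at level K
    -- + 1.
    rw [Finset.sum_range_succ', add_zero] at hxy
    set S := ∑ k ∈ Finset.range n, Real.exp (-l (K + (k + 1)) - 1) with hS
    have hS0 : 0 ≤ S := Finset.sum_nonneg fun k _ => (Real.exp_pos _).le
    have hE := Real.exp_pos (-l K - 1)
    obtain ⟨z, hz, hzx, hyz⟩ : ∃ z ∈ s, |v z - v x| ≤ S ∧ |v y - v z| ≤ Real.exp (-l K - 1) := by
      rw [abs_le] at hxy
      rcases le_total (v x) (v y) with hle | hle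
      · obtain ⟨z, hz, hvz⟩ := hs.intermediate_value hx hy hv
          (⟨le_min hle (by linarith), min_le_left _ _⟩ :
            min (v y) (v x + S) ∈ Icc (v x) (v y))
        refine ⟨z, hz, ?_, ?_⟩ <;> rw [hvz, abs_le] <;>
          rcases min_cases (v y) (v x + S) with ⟨h, h'⟩ | ⟨h, h'⟩ <;> rw [h] <;>
          constructor <;> linarith
      · obtain ⟨z, hz, hvz⟩ := hs.intermediate_value hy hx hv
          (⟨le_max_left _ _, max_le hle (by linarith)⟩ :
            max (v y) (v x - S) ∈ Icc (v y) (v x))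
        refine ⟨z, hz, ?_, ?_⟩ <;> rw [hvz, abs_le] <;>
          rcases max_cases (v y) (v x - S) with ⟨h, h'⟩ | ⟨h, h'⟩ <;> rw [h] <;>
          constructor <;> linarith
    refine hu.le_exp_of_abs_sub_le hA hl hl' hAL hL hz hy hyz (fun i hi => ?_) hj
    have := ih (K + 1) z hz (by simpa only [hS, add_assoc, add_comm 1] using hzx) i
      (hi.trans (hl K.le_succ))
    simpa using this

/-- Tails of a divergent series diverge, so y is reached from every starting level K, with the bound
exp(A 0 - K). -/
theorem IsExpControlled.le_zero_of_not_summable (hv : ContinuousOn v s) (hs : IsPreconnected s)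
    {x : ℝ} (hx : x ∈ s) (h0 : ∀ j, u j x ≤ 0) (hsum : ¬ Summable fun k => Real.exp (-l k)) :
    ∀ y ∈ s, u 0 y ≤ 0 := by
  intro y hy
  have hlim : Tendsto (fun K : ℕ => Real.exp (A 0) * Real.exp (-(K : ℝ))) atTop (𝓝 0) := by
    simpa using (Real.tendsto_exp_neg_atTop_nhds_zero.comp tendsto_natCast_atTop_atTop).const_mul
      (Real.exp (A 0))
  refine ge_of_tendsto' hlim fun K => ?_
  have hns : ¬ Summable fun k => Real.exp (-l (K + k) - 1) := by
    intro h
    refine hsum ((summable_nat_add_iff K).1 ((h.mul_left (Real.exp 1)).congr fun k => ?_))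
    rw [← Real.exp_add, add_comm K k]
    ring_nf
  obtain ⟨n, hn⟩ := ((tendsto_atTop.1 ((not_summable_iff_tendsto_nat_atTop_of_nonneg
    fun k => (Real.exp_pos _).le).1 hns)) |v y - v x|).exists
  have := hu.le_exp_of_abs_sub_le_sum hA hl hl' hAL hL hv hs hx h0 n K y hy hn 0 (hl K.zero_le)
  rw [← Real.exp_add]
  simpa [sub_eq_add_neg] using this

end ExpControlled

/-- **Denjoy–Carleman theorem** for sequences of functions tied by integral inequalities. -/
theorem IsExpControlled.le_zero {u : ℕ → ℝ → ℝ} {v : ℝ → ℝ} {s : Set ℝ}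
    (hu : IsExpControlled u v s) (hv : ContinuousOn v s) (hs : IsPreconnected s) {L : ℕ → ℝ}
    (hL : ∀ j, ∀ t ∈ s, u j t ≤ Real.exp (L j))
    (hsum : ¬ Summable fun n : ℕ => Real.exp (-L (n + 1) / (n + 1)))
    {x : ℝ} (hx : x ∈ s) (h0 : ∀ j, u j x ≤ 0) : ∀ y ∈ s, u 0 y ≤ 0 := by
  by_cases hlim : Tendsto (fun n : ℕ => L n / n) atTop atTop
  · refine hu.le_zero_of_not_summable (A := convexMinorant L)
      (l := fun n => convexMinorant L (n + 1) - convexMinorant L n) (fun n => by ring)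
      (monotone_convexMinorant_succ_sub hlim) (exists_lt_convexMinorant_succ_sub hlim)
      (fun n h => convexMinorant_eq_of_lt hlim h) hL hv hs hx h0 fun hl => hsum ?_
    set l := fun n => convexMinorant L (n + 1) - convexMinorant L n with hldef
    -- The averages of l telescope to (A (n + 1) - A 0) / (n + 1), with A the minorant; the factor
    -- exp |A 0| below absorbs the term A 0.
    have hmean : Summable fun n : ℕ =>
        Real.exp (-(∑ k ∈ Finset.range (n + 1), l k) / (n + 1)) := by
      refine summable_of_sum_range_le (c := 2 * Real.exp 1 * ∑' k, Real.exp (-l k))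
        (fun n => (Real.exp_pos _).le) fun N => (sum_exp_neg_average_le l N).trans ?_
      have := hl.sum_le_tsum (Finset.range N) fun k _ => (Real.exp_pos (-l k)).le
      gcongr
    refine (hmean.mul_left (Real.exp |convexMinorant L 0|)).of_nonneg_of_le
      (fun n => (Real.exp_pos _).le) fun n => ?_
    rw [← Real.exp_add, hldef, Finset.sum_range_sub]
    refine Real.exp_le_exp.2 ?_
    have hn : (0 : ℝ) < n + 1 := by positivity
    have h1 : -convexMinorant L 0 / (n + 1) ≤ |convexMinorant L 0| := by
      rw [div_le_iff₀ hn]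
      nlinarith [neg_abs_le (convexMinorant L 0), abs_nonneg (convexMinorant L 0),
        (Nat.cast_nonneg n : (0 : ℝ) ≤ n)]
    have h2 : -L (n + 1) / (n + 1) ≤ -convexMinorant L (n + 1) / (n + 1) := by
      have := convexMinorant_le hlim (n + 1)
      gcongr
    have h3 : -(convexMinorant L (n + 1) - convexMinorant L 0) / ((n : ℝ) + 1) =
        -convexMinorant L (n + 1) / (n + 1) - -convexMinorant L 0 / (n + 1) := by ring
    linarith
  -- Here L n < c n for infinitely many n, and no regularization is needed.
  · rw [tendsto_atTop] at hlim
    push Not at hlim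
    obtain ⟨c, hc⟩ := hlim
    refine hu.le_zero_of_frequently hx hL (c := c) ?_ h0
    refine (hc.and_eventually (eventually_gt_atTop 0)).mono ?_
    rintro n ⟨h, hn⟩
    exact ((div_lt_iff₀ (by exact_mod_cast hn)).1 h).le

/-! ### Path integrals estimated by arc length -/

namespace PlanePath

/-- A path integral is bounded by the increment of `φ` if that of `φ` bounds the terms of the
Riemann–Stieltjes sums with tags chosen by `σ`. -/
theorem HasIntegral.norm_le {γ : PlanePath} {g : ℂ → ℂ} {I : ℂ} (h : γ.HasIntegral g I)
    {φ : ℝ → ℝ} {σ : ℝ → ℝ → ℝ} (hσ : ∀ t t', t ≤ t' → σ t t' ∈ Icc t t')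
    (hφ : ∀ t ∈ Icc γ.a γ.b, ∀ t' ∈ Icc γ.a γ.b, t ≤ t' →
      ‖g (γ (σ t t'))‖ * ‖γ t' - γ t‖ ≤ φ t' - φ t) :
    ‖I‖ ≤ φ γ.b - φ γ.a := by
  refine le_of_forall_pos_le_add fun ε hε => ?_
  obtain ⟨δ, hδ, H⟩ := h ε hε
  obtain ⟨n, t, hm, hmem, ht⟩ := exists_isTaggedPartition γ.lt hδ
  have hS := H n t (fun i => σ (t i) (t (i + 1)))
    ⟨ht.left, ht.right, fun i _ => hσ _ _ (hm i.le_succ), ht.mesh⟩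
  have hB : ‖∑ i ∈ Finset.range n, g (γ (σ (t i) (t (i + 1)))) * (γ (t (i + 1)) - γ (t i))‖ ≤
      φ γ.b - φ γ.a := by
    rw [← ht.left, ← ht.right, ← Finset.sum_range_sub (fun i => φ (t i))]
    refine norm_sum_le_of_le _ fun i hi => ?_
    rw [norm_mul]
    have hi := Finset.mem_range.1 hi
    exact hφ _ (hmem i hi.le) _ (hmem (i + 1) hi) (hm i.le_succ)
  have := norm_le_norm_add_norm_sub
    (∑ i ∈ Finset.range n, g (γ (σ (t i) (t (i + 1)))) * (γ (t (i + 1)) - γ (t i))) I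
  linarith

/-- Arc length along `γ`, measured from the initial point. -/
noncomputable def arcLength (γ : PlanePath) : ℝ → ℝ :=
  variationOnFromTo γ.toFun (Icc γ.a γ.b) γ.a

variable {γ : PlanePath} (hγ : γ.IsRectifiable)
include hγ

theorem IsRectifiable.locallyBoundedVariationOn :
    LocallyBoundedVariationOn γ.toFun (Icc γ.a γ.b) :=
  BoundedVariationOn.locallyBoundedVariationOn hγ.ne

theorem IsRectifiable.norm_sub_le_arcLength {t t' : ℝ} (ht : t ∈ Icc γ.a γ.b)
    (ht' : t' ∈ Icc γ.a γ.b) (h : t ≤ t') : ‖γ t' - γ t‖ ≤ γ.arcLength t' - γ.arcLength t := by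
  rw [arcLength, variationOnFromTo.sub_right hγ.locallyBoundedVariationOn
    (left_mem_Icc.2 γ.lt.le) ht' ht, variationOnFromTo.eq_of_le _ _ h, ← dist_eq_norm]
  exact BoundedVariationOn.dist_le (hγ.locallyBoundedVariationOn t t' ht ht')
    ⟨ht', h, le_rfl⟩ ⟨ht, le_rfl, h⟩

/-- The variation function jumps exactly by the jumps of the path, and there are none. -/
theorem IsRectifiable.continuousOn_arcLength : ContinuousOn γ.arcLength (Icc γ.a γ.b) := by
  intro t ht
  have hleft := variationOnFromTo.tendsto_left (left_mem_Icc.2 γ.lt.le) ht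
    hγ.locallyBoundedVariationOn ((γ.continuousOn t ht).mono inter_subset_left)
  have hright := variationOnFromTo.tendsto_right (left_mem_Icc.2 γ.lt.le) ht
    hγ.locallyBoundedVariationOn ((γ.continuousOn t ht).mono inter_subset_left)
  simp only [dist_self, sub_zero, add_zero] at hleft hright
  rw [← continuousWithinAt_sdiff_self, show Icc γ.a γ.b \ {t} =
    Icc γ.a γ.b ∩ Iio t ∪ Icc γ.a γ.b ∩ Ioi t by
      rw [← inter_union_distrib_left, Iio_union_Ioi, sdiff_eq]]
  exact ContinuousWithinAt.union hleft hright

/-- The bound for the integral over a subpath of a function that grows exponentially in the arc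
length from its initial point. -/
theorem IsRectifiable.norm_integral_le_of_left {x y : ℝ} (hax : γ.a ≤ x) (hxy : x < y)
    (hyb : y ≤ γ.b) {g : ℂ → ℂ} {I : ℂ} (h : (γ.restrict x y hax hxy hyb).HasIntegral g I)
    {C r : ℝ} (hC : 0 ≤ C) (hr : 0 < r) (hg : ∀ τ ∈ Icc x y,
      ‖g (γ τ)‖ ≤ C * Real.exp (r * (γ.arcLength τ - γ.arcLength x))) :
    ‖I‖ ≤ C * ((Real.exp (r * (γ.arcLength y - γ.arcLength x)) - 1) / r) := by
  -- φ is a primitive of the bound in arc length. The bound increases, so left tags keep each term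
  -- below the increment of φ.
  have key := h.norm_le (σ := fun t _ => t)
    (φ := fun t => C * (Real.exp (r * (γ.arcLength t - γ.arcLength x)) / r))
    (fun t t' ht => ⟨le_rfl, ht⟩) ?_
  · refine key.trans (le_of_eq ?_)
    change C * (Real.exp (r * (γ.arcLength y - γ.arcLength x)) / r) -
      C * (Real.exp (r * (γ.arcLength x - γ.arcLength x)) / r) = _
    rw [sub_self, mul_zero, Real.exp_zero]
    ring
  · intro t (ht : t ∈ Icc x y) t' (ht' : t' ∈ Icc x y) htt'
    have hd := hγ.norm_sub_le_arcLength ⟨hax.trans ht.1, ht.2.trans hyb⟩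
      ⟨hax.trans ht'.1, ht'.2.trans hyb⟩ htt'
    refine (mul_le_mul (hg t ht) hd (norm_nonneg _) (by positivity)).trans ?_
    rw [mul_assoc, ← mul_sub, ← sub_div]
    refine mul_le_mul_of_nonneg_left ((le_div_iff₀ hr).2 ?_) hC
    have h1 := Real.add_one_le_exp (r * (γ.arcLength t' - γ.arcLength t))
    have h2 : Real.exp (r * (γ.arcLength t' - γ.arcLength x)) =
        Real.exp (r * (γ.arcLength t - γ.arcLength x)) *
          Real.exp (r * (γ.arcLength t' - γ.arcLength t)) := by
      rw [← Real.exp_add]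
      ring_nf
    rw [h2]
    nlinarith [Real.exp_pos (r * (γ.arcLength t - γ.arcLength x))]

/-- The bound for the integral over a subpath of a function that grows exponentially in the arc
length from its final point. -/
theorem IsRectifiable.norm_integral_le_of_right {x y : ℝ} (hax : γ.a ≤ x) (hxy : x < y)
    (hyb : y ≤ γ.b) {g : ℂ → ℂ} {I : ℂ} (h : (γ.restrict x y hax hxy hyb).HasIntegral g I)
    {C r : ℝ} (hC : 0 ≤ C) (hr : 0 < r) (hg : ∀ τ ∈ Icc x y,
      ‖g (γ τ)‖ ≤ C * Real.exp (r * (γ.arcLength y - γ.arcLength τ))) :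
    ‖I‖ ≤ C * ((Real.exp (r * (γ.arcLength y - γ.arcLength x)) - 1) / r) := by
  -- Now the bound decreases along the path, so right tags are the ones that work.
  have key := h.norm_le (σ := fun _ t' => t')
    (φ := fun t => -(C * (Real.exp (r * (γ.arcLength y - γ.arcLength t)) / r)))
    (fun t t' ht => ⟨ht, le_rfl⟩) ?_
  · refine key.trans (le_of_eq ?_)
    change -(C * (Real.exp (r * (γ.arcLength y - γ.arcLength y)) / r)) -
      -(C * (Real.exp (r * (γ.arcLength y - γ.arcLength x)) / r)) = _
    rw [sub_self, mul_zero, Real.exp_zero]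
    ring
  · intro t (ht : t ∈ Icc x y) t' (ht' : t' ∈ Icc x y) htt'
    have hd := hγ.norm_sub_le_arcLength ⟨hax.trans ht.1, ht.2.trans hyb⟩
      ⟨hax.trans ht'.1, ht'.2.trans hyb⟩ htt'
    refine (mul_le_mul (hg t' ht') hd (norm_nonneg _) (by positivity)).trans ?_
    rw [neg_sub_neg, mul_assoc, ← mul_sub, ← sub_div]
    refine mul_le_mul_of_nonneg_left ((le_div_iff₀ hr).2 ?_) hC
    have h1 := Real.add_one_le_exp (r * (γ.arcLength t' - γ.arcLength t))
    have h2 : Real.exp (r * (γ.arcLength y - γ.arcLength t)) =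
        Real.exp (r * (γ.arcLength y - γ.arcLength t')) *
          Real.exp (r * (γ.arcLength t' - γ.arcLength t)) := by
      rw [← Real.exp_add]
      ring_nf
    rw [h2]
    nlinarith [Real.exp_pos (r * (γ.arcLength y - γ.arcLength t'))]

/-- The increment of F j between two parameters is an integral over the subpath between them. The
base point x is its initial or its final point, whence the two estimates above. -/
theorem IsRectifiable.isExpControlled {F : ℕ → ℂ → ℂ}
    (hF : ∀ k, IsFDerivative γ.image γ.subpathsAndReverses (F k) (F (k + 1))) :
    IsExpControlled (fun k t => ‖F k (γ t)‖) γ.arcLength (Icc γ.a γ.b) := by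
  have hmono : ∀ t ∈ Icc γ.a γ.b, ∀ t' ∈ Icc γ.a γ.b, t ≤ t' →
      γ.arcLength t ≤ γ.arcLength t' := fun t ht t' ht' h =>
    sub_nonneg.1 ((norm_nonneg _).trans (hγ.norm_sub_le_arcLength ht ht' h))
  intro j x hx y hy C r hC hr hg
  rcases lt_trichotomy x y with hxy | rfl | hxy
  · have hI := (hF j).2.2 (γ.restrict x y hx.1 hxy hy.2) (Or.inl ⟨x, y, hx.1, hxy, hy.2, rfl⟩)
    have key := hγ.norm_integral_le_of_left hx.1 hxy hy.2 hI hC hr fun τ hτ => by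
      have hτ' : τ ∈ Icc γ.a γ.b := ⟨hx.1.trans hτ.1, hτ.2.trans hy.2⟩
      simpa only [abs_of_nonneg (sub_nonneg.2 (hmono x hx τ hτ' hτ.1))] using hg τ hτ'
    rw [abs_of_nonneg (sub_nonneg.2 (hmono x hx y hy hxy.le))]
    change ‖F j (γ y) - F j (γ x)‖ ≤ _ at key
    have := norm_le_norm_add_norm_sub (F j (γ x)) (F j (γ y))
    rw [norm_sub_rev] at this
    linarith
  · simp
  · have hI := (hF j).2.2 (γ.restrict y x hy.1 hxy hx.2) (Or.inl ⟨y, x, hy.1, hxy, hx.2, rfl⟩)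
    have key := hγ.norm_integral_le_of_right hy.1 hxy hx.2 hI hC hr fun τ hτ => by
      have hτ' : τ ∈ Icc γ.a γ.b := ⟨hy.1.trans hτ.1, hτ.2.trans hx.2⟩
      simpa only [abs_sub_comm _ (γ.arcLength x),
        abs_of_nonneg (sub_nonneg.2 (hmono τ hτ' x hx hτ.2))] using hg τ hτ'
    rw [abs_sub_comm, abs_of_nonneg (sub_nonneg.2 (hmono y hy x hx hxy.le))]
    change ‖F j (γ x) - F j (γ y)‖ ≤ _ at key
    have := norm_le_norm_add_norm_sub (F j (γ x)) (F j (γ y))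
    linarith

end PlanePath

/-! ### Iterated derivatives and conclusion -/

theorem isFDerivative_fDeriv {X : Set ℂ} {F : Set PlanePath} {f : ℂ → ℂ}
    (h : ∃ g, IsFDerivative X F f g) : IsFDerivative X F f (fDeriv X F f) := by
  rw [fDeriv, dif_pos h]
  exact h.choose_spec

/-- Both `fDiff` and function iteration unfold by differentiating f first, so the induction must let
f vary. -/
theorem isFDerivative_iterFDeriv {X : Set ℂ} {F : Set PlanePath} (k : ℕ) :
    ∀ {f : ℂ → ℂ}, f ∈ fDiff X F (k + 1) →
      IsFDerivative X F (iterFDeriv X F k f) (iterFDeriv X F (k + 1) f) := by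
  induction k with
  | zero => exact fun h => isFDerivative_fDeriv h.1
  | succ k ih => exact fun h => ih h.2

theorem not_summable_exp_neg_log_div {M : ℕ → ℝ} (hM : ∀ n, 0 < M n)
    (h : Tendsto (fun N : ℕ => ∑ n ∈ Finset.Icc 1 N, M n ^ (-(1 / (n : ℝ)))) atTop atTop) :
    ¬ Summable fun n : ℕ => Real.exp (-Real.log (M (n + 1)) / (n + 1)) := by
  rw [not_summable_iff_tendsto_nat_atTop_of_nonneg fun n => (Real.exp_pos _).le]
  refine h.congr fun N => ?_
  induction N with
  | zero => simp
  | succ N ih =>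
    rw [Finset.sum_Icc_succ_top (by omega), ih, Finset.sum_range_succ, Real.rpow_def_of_pos (hM _)]
    congr 2
    push_cast
    ring

theorem mainTheorem1 (Γ : PlanePath) (hΓ : Γ.IsAdmissible)
    (F : Set PlanePath) (hF : F = Γ.subpathsAndReverses)
    (M : ℕ → ℝ) (hMpos : ∀ n, 0 < M n)
    (hMsum : Tendsto (fun N : ℕ => ∑ n ∈ Finset.Icc 1 N, M n ^ (-(1 / (n : ℝ)))) atTop atTop)
    (f : ℂ → ℂ) (hf : f ∈ fDiffInfty Γ.image F)
    (hfM : ∀ k : ℕ, ∀ z ∈ Γ.image, ‖iterFDeriv Γ.image F k f z‖ ≤ M k)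
    (z₀ : ℂ) (hz₀ : z₀ ∈ Γ.image)
    (hfz₀ : ∀ k : ℕ, iterFDeriv Γ.image F k f z₀ = 0) :
    ∀ z ∈ Γ.image, f z = 0 := by
  subst hF
  obtain ⟨x, hx, rfl⟩ := hz₀
  rintro _ ⟨y, hy, rfl⟩
  have hctrl := hΓ.1.isExpControlled (F := fun k => iterFDeriv Γ.image Γ.subpathsAndReverses k f)
    fun k => isFDerivative_iterFDeriv k (mem_iInter.1 hf (k + 1))
  have h := hctrl.le_zero hΓ.1.continuousOn_arcLength isPreconnected_Icc
    (L := fun n => Real.log (M n))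
    (fun j t ht => by
      rw [Real.exp_log (hMpos j)]
      exact hfM j _ (mem_image_of_mem _ ht))
    (not_summable_exp_neg_log_div hMpos hMsum) hx
    (fun j => (norm_eq_zero.2 (hfz₀ j)).le) y hy
  exact norm_le_zero_iff.1 h
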